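/- Let $\overline{\mathbb Q}$ be an algebraic closure of $\mathbb Q$, and let number fields be the finite extensions of $\mathbb Q$ inside $\overline{\mathbb Q}$. For a number field $K$ let $M_K$ be its set of places, with the discrete topology; for $v\in M_K$ let $\|\cdot\|_v$ be the absolute value in the class $v$ that extends the usual archimedean or $p$-adic absolute value of $\mathbb Q$. Let $Y=\varprojlim_K M_K$ be the projective limit over all number fields (with respect to restriction of places), that is, the space of places of $\overline{\mathbb Q}$, and for $v\in M_K$ let $Y(K,v)=\{y\in Y: y\mid v\}$. Let $\lambda$ be the Borel measure on $Y$ with $\lambda(Y(K,v))=[K_v:\mathbb Q_v]/[K:\mathbb Q]$ for every number field $K$ and every $v\in M_K$; equivalently, $\lambda$ restricts on each $Y(\mathbb Q,u)$, $u$ a place of $\mathbb Q$, to the unique probability measure invariant under $\mathrm{Gal}(\overline{\mathbb Q}/\mathbb Q)$. For $\alpha\in\overline{\mathbb Q}^\times$ let $f_\alpha:Y\to\mathbb R$, $f_\alpha(y)=\log\|\alpha\|_y$. For a compact open set $S\subseteq Y$ put $$\mathcal F(S)=\{f_\alpha:\alpha\in\overline{\mathbb Q}^\times,\ \operatorname{supp}(f_\alpha)\subseteq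 S\},$$ and $$\mathcal F_p(S,0)=\Big\{f\in L^p(Y,\lambda):\operatorname{supp}(f)\subseteq S,\ \int_S f\,d\lambda=0\Big\}\quad(1\le p<\infty),$$ $$\mathcal F_\infty(S,0)=\Big\{f\in C_0(Y):\operatorname{supp}(f)\subseteq S,\ \int_S f\,d\lambda=0\Big\},$$ where $C_0(Y)$ is the space of continuous real functions on $Y$ vanishing at infinity, with the supremum norm. **Theorem.** Let $S\subseteq Y$ be a compact open set that contains no archimedean place, i.e. $S\cap Y(\mathbb Q,\infty)=\varnothing$. Suppose that $S$ is defined over a number field $K$ that has at least one real place, i.e. $S=\bigcup_{v\in T}Y(K,v)$ for some $T\subseteq M_K$, and that $Y(K,v)\cup Y(K,w)\subseteq S$ for two distinct places $v\neq w$ of $K$. Then, for every $1\le p\le\infty$, the closure of $\mathcal F(S)$ in the $L^p$ norm is a proper subspace of the real vector space $\mathcal F_p(S,0)$: it is a real linear subspace contained in $\mathcal F_p(S,0)$ and not equal to it. -/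

import Mathlib

open scoped ENNReal ZeroAtInfty

noncomputable section

namespace WeilHeight

/-- The algebraic numbers `ℚ̄`. -/
abbrev Qbar : Type := AlgebraicClosure ℚ

instance : Algebra.IsAlgebraic ℚ Qbar := by
  have h := AlgebraicClosure.isAlgebraic ℚ
  rwa [Subsingleton.elim (AlgebraicClosure.instAlgebra ℚ) (DivisionRing.toRatAlgebra)] at h

instance : IsAlgClosure ℚ Qbar := ⟨inferInstance, inferInstance⟩

instance : IsGalois ℚ Qbar := IsAlgClosure.isGalois ℚ Qbar

/-! ### Number fields and their places -/

/-- The number fields, as the finite extensions of `ℚ` inside `ℚ̄`, ordered by inclusion. -/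
abbrev NumField : Type := {K : IntermediateField ℚ Qbar // FiniteDimensional ℚ K}

/-- A place of a field `F` of characteristic zero that is algebraic over `ℚ`. Each equivalence
class of nontrivial absolute values is represented by its unique member `‖·‖_v` that extends the
usual absolute value of `ℚ` or the usual `p`-adic absolute value of `ℚ` for a prime `p`. -/
def Place (F : Type) [Field F] : Type :=
  {v : AbsoluteValue F ℝ //
    (∀ q : ℚ, v (q : F) = |(q : ℝ)|) ∨ ∃ p : ℕ, p.Prime ∧ ∀ q : ℚ, v (q : F) = padicNorm p q}

/-- A place lies over the place `∞` of `ℚ`. -/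
def Place.IsArchimedean {F : Type} [Field F] (v : Place F) : Prop :=
  ∀ q : ℚ, v.1 (q : F) = |(q : ℝ)|

/-- The pullback of a place along a homomorphism of fields; for an inclusion, the restriction. -/
def Place.comap {E F : Type} [Field E] [Field F] (φ : E →+* F) (v : Place F) : Place E :=
  ⟨v.1.comp φ.injective, by
    have h (q : ℚ) : v.1.comp φ.injective (q : E) = v.1 (q : F) :=
      congrArg v.1 (map_ratCast φ q)
    simpa only [h] using v.2⟩

/-- The set `M_K` of places of a number field carries the discrete topology. -/
instance (K : NumField) : TopologicalSpace (Place K.1) := ⊥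

instance (K : NumField) : DiscreteTopology (Place K.1) := ⟨rfl⟩

/-! ### The space of places of `ℚ̄` -/

/-- `Y` is the projective limit of the discrete spaces `M_K` over all number fields `K`, with
respect to the restriction of places. -/
def Y : Type :=
  {y : ∀ K : NumField, Place K.1 //
    ∀ (K L : NumField) (h : K.1 ≤ L.1),
      (y L).comap (IntermediateField.inclusion h).toRingHom = y K}

instance : TopologicalSpace Y := instTopologicalSpaceSubtype

instance : MeasurableSpace Y := borel Y

instance : BorelSpace Y := ⟨rfl⟩

/-- `Y(K,v)`, the set of all `y ∈ Y` lying over the place `v` of `K`. -/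
def Y.over (K : NumField) (v : Place K.1) : Set Y := {y | y.1 K = v}

/-- The number field `ℚ`. -/
def ratField : NumField := ⟨⊥, inferInstance⟩

/-- `Y(ℚ,∞)`, the set of archimedean places. -/
def Y.archimedean : Set Y := {y | (y.1 ratField).IsArchimedean}

/-- `S` is defined over `K`: it is a union of sets `Y(K,v)` for places `v` of `K`. -/
def IsDefinedOver (S : Set Y) (K : NumField) : Prop :=
  ∃ T : Set (Place K.1), S = ⋃ v ∈ T, Y.over K v

/-- The number field `ℚ(α)`. -/
def adjoinField (α : Qbar) : NumField :=
  ⟨IntermediateField.adjoin ℚ {α},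
    IntermediateField.adjoin.finiteDimensional (Algebra.IsIntegral.isIntegral α)⟩

/-- `‖α‖_y` for `α ∈ ℚ̄` and `y ∈ Y`. -/
def Y.abs (y : Y) (α : Qbar) : ℝ :=
  (y.1 (adjoinField α)).1 (IntermediateField.AdjoinSimple.gen ℚ α)

/-- The function `f_α : Y → ℝ`, `f_α(y) = log ‖α‖_y`. -/
def logAbs (α : Qbar) (y : Y) : ℝ := Real.log (y.abs α)

/-! ### The measure on `Y` -/

/-- The point of `Y` given by a place of `ℚ̄`. -/
def Y.ofPlace (P : Place Qbar) : Y :=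
  ⟨fun K => P.comap (algebraMap K.1 Qbar), fun _ _ _ => rfl⟩

/-- An archimedean place of `ℚ̄`, from an embedding of `ℚ̄` into `ℂ`. -/
def placeInfty : Place Qbar :=
  ⟨(NormedField.toAbsoluteValue ℂ).comp
      (f := (IsAlgClosed.lift : Qbar →ₐ[ℚ] ℂ).toRingHom) (RingHom.injective _),
    Or.inl fun q => by
      change ‖(IsAlgClosed.lift : Qbar →ₐ[ℚ] ℂ) (q : Qbar)‖ = _
      rw [map_ratCast, ← Complex.ofReal_ratCast, Complex.norm_real, Real.norm_eq_abs]⟩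

/-- A `p`-adic place of `ℚ̄`, from an embedding of `ℚ̄` into an algebraic closure of `ℚ_p`. -/
def placePadic (p : ℕ) [hp : Fact p.Prime] : Place Qbar :=
  ⟨(NormedField.toAbsoluteValue (PadicAlgCl p)).comp
      (f := (IsAlgClosed.lift : Qbar →ₐ[ℚ] PadicAlgCl p).toRingHom) (RingHom.injective _),
    Or.inr ⟨p, hp.out, fun q => by
      change ‖(IsAlgClosed.lift : Qbar →ₐ[ℚ] PadicAlgCl p) (q : Qbar)‖ = _
      rw [map_ratCast, ← map_ratCast (algebraMap ℚ_[p] (PadicAlgCl p)), PadicAlgCl.norm_extends,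
        Padic.eq_padicNorm]⟩⟩

/-- The absolute Galois group, a compact group for the Krull topology. -/
abbrev GalQ : Type := Gal(Qbar/ℚ)

instance : MeasurableSpace GalQ := borel GalQ

instance : BorelSpace GalQ := ⟨rfl⟩

/-- The Haar measure of total mass one on the absolute Galois group. -/
def galHaar : MeasureTheory.Measure GalQ := MeasureTheory.Measure.haarMeasure ⊤

/-- The place `σP` of `ℚ̄`, given by `‖α‖_{σP} = ‖σ⁻¹α‖_P`, as a point of `Y`. -/
def galOrbit (P : Place Qbar) (σ : GalQ) : Y :=
  Y.ofPlace (P.comap (σ⁻¹ : GalQ).toRingEquiv.toRingHom)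

/-- The measure `λ` on `Y`. The Galois group acts continuously and transitively on each of the
compact open sets `Y(ℚ,∞)` and `Y(ℚ,p)`, and on each of them `λ` is the image of the normalized
Haar measure under an orbit map, that is, the unique invariant probability measure. So for a
place `v` of a number field `K` over the place `u` of `ℚ`, `λ(Y(K,v))` is the proportion, among
the `[K:ℚ]` embeddings of `K` into an algebraic closure of `ℚ_u`, of those that induce `v`, which
is `[K_v:ℚ_v]/[K:ℚ]`; these values determine the Borel measure `λ`. -/
def placeMeasure : MeasureTheory.Measure Y :=
  galHaar.map (galOrbit placeInfty) +
    MeasureTheory.Measure.sum fun p : Nat.Primes =>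
      haveI : Fact (p : ℕ).Prime := ⟨p.2⟩
      galHaar.map (galOrbit (placePadic p))

/-! ### The spaces of `S`-units -/

/-- `ℱ(S)`: the functions `f_α`, for nonzero algebraic `α`, with support in `S`. -/
def unitFunctions (S : Set Y) : Set (Y → ℝ) :=
  {f | (∃ α : Qbar, α ≠ 0 ∧ f = logAbs α) ∧ tsupport f ⊆ S}

/-- `ℱ(S)` inside `L^p(Y,λ)`. -/
def unitLp (p : ℝ≥0∞) (S : Set Y) : Set (MeasureTheory.Lp ℝ p placeMeasure) :=
  {g | ∃ f ∈ unitFunctions S, g =ᵐ[placeMeasure] f}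

/-- `ℱ(S)` inside `C₀(Y)`. -/
def unitC₀ (S : Set Y) : Set C₀(Y, ℝ) :=
  {g | (g : Y → ℝ) ∈ unitFunctions S}

/-- `ℱ_p(S,0)` for `1 ≤ p < ∞`: the functions in `L^p(Y,λ)` that are supported on `S` and have
integral zero. -/
def hyperplaneLp (p : ℝ≥0∞) (S : Set Y) : Set (MeasureTheory.Lp ℝ p placeMeasure) :=
  {g | (∀ᵐ y ∂placeMeasure, y ∉ S → g y = 0) ∧ ∫ y in S, g y ∂placeMeasure = 0}

/-- `ℱ_∞(S,0)`: the functions in `C₀(Y)` that are supported on `S` and have integral zero. -/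
def hyperplaneC₀ (S : Set Y) : Set C₀(Y, ℝ) :=
  {g | tsupport g ⊆ S ∧ ∫ y in S, g y ∂placeMeasure = 0}

end WeilHeight

end

/-!
The closure of `ℱ(S)` misses part of `ℱ_p(S,0)` because the integral over the single set `Y(K,v)`
already vanishes on `ℱ(S)`, not only the integral over `S`.

Let `f_α` be supported in `S`. As `S` contains no archimedean place, every complex embedding of
`ℚ̄` maps `α` to the unit circle. Let `N ∈ K` be the product of the conjugates of `α` over `K`. All
conjugates of `N` lie on the unit circle too, and a real embedding of `K` maps `N` to a real number
of absolute value one, so `N = ±1` (`prod_conjugates_eq`) and `f_N = 0`. On the other hand, a set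
`B ⊆ Y` that is defined over `K` pulls back, along each orbit map, to a set that is stable under
`Gal(ℚ̄/K)`, so invariance of the Haar measure gives all conjugates of `α` over `K` the same
integral over `B`. These integrals add up to that of `f_N`; hence they vanish
(`setIntegral_unitFunction_eq_zero`). The case `B = S` is the inclusion in the hyperplane, and the
case `B = Y(K,v)` is a further linear condition, which is continuous in every norm in question.

The condition fails for a combination of the indicator functions of `Y(K,v)` and `Y(K,w)` that has
integral zero over `S`, provided both sets have positive measure. This holds because every place
of `K` is induced by a Galois conjugate of the chosen place of `ℚ̄` (`exists_galois_apply_eq`);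
the proof, by weak approximation, treats archimedean and `p`-adic places alike.

Finally `ℱ(S)` is a vector space over `ℚ`, by products and roots of algebraic numbers, so its
closure is a vector space over `ℝ`.
-/

noncomputable section

namespace WeilHeight

/-! ### Places of number fields and conjugation -/

lemma Place.exists_ratCast_apply_ne_one {F : Type} [Field F] (v : Place F) :
    ∃ q : ℚ, q ≠ 0 ∧ v.1 (q : F) ≠ 1 := by
  rcases v.2 with h | ⟨p, hp, h⟩
  · exact ⟨2, two_ne_zero, by rw [h]; norm_num⟩
  · refine ⟨p, by exact_mod_cast hp.ne_zero, ?_⟩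
    rw [h, padicNorm.padicNorm_p hp.one_lt]
    have : (1 : ℝ) < p := by exact_mod_cast hp.one_lt
    push_cast
    exact (inv_lt_one_of_one_lt₀ this).ne

lemma eq_of_isEquiv_of_apply_eq {F : Type} [Field F] {u u' : AbsoluteValue F ℝ}
    (h : u.IsEquiv u') {x : F} (h0 : x ≠ 0) (h1 : u x ≠ 1) (hx : u x = u' x) : u = u' := by
  obtain ⟨c, hc, hcu⟩ := AbsoluteValue.isEquiv_iff_exists_rpow_eq.1 h
  have hpos : 0 < u x := u.pos h0
  have h2 : u x ^ c = u x ^ (1 : ℝ) := by rw [Real.rpow_one]; exact (congrFun hcu x).trans hx.symm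
  have h3 : c = 1 := (Real.rpow_right_inj hpos h1).1 h2
  ext y
  rw [← congrFun hcu y, h3, Real.rpow_one]

/-- An element all of whose conjugates are small at `P` is small at every `v` that agrees with
`P` on `ℚ`: its minimal polynomial has small lower coefficients. -/
lemma apply_le_one_of_conjugates_small (K : NumField) (v : Place K.1) (P : Place Qbar)
    (h : ∀ q : ℚ, v.1 (q : K.1) = P.1 (q : Qbar)) (b : K.1) (ε : ℝ) (hε : ε ≤ 1)
    (hεd : ε * 2 ^ (Module.finrank ℚ K.1) * Module.finrank ℚ K.1 < 1) (hε0 : 0 ≤ ε)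
    (hb : ∀ σ : GalQ, P.1 (σ b) ≤ ε) : v.1 b ≤ 1 := by
  have := K.2
  by_contra! hv
  have hint : IsIntegral ℚ b := Algebra.IsIntegral.isIntegral b
  set q := minpoly ℚ b with hq
  set n := q.natDegree with hn
  set d := Module.finrank ℚ K.1
  have hnd : n ≤ d := minpoly.natDegree_le b
  have hn0 : 0 < n := minpoly.natDegree_pos hint
  have hqQ : q = minpoly ℚ (b : Qbar) :=
    (minpoly.algebraMap_eq (algebraMap K.1 Qbar).injective b).symm
  have hroots : ∀ z ∈ (q.map (algebraMap ℚ Qbar)).roots, P.1 z ≤ ε := by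
    intro z hz
    have hz' : Polynomial.aeval z (minpoly ℚ (b : Qbar)) = 0 := by
      rw [← hqQ, Polynomial.aeval_def, ← Polynomial.eval_map]
      exact Polynomial.isRoot_of_mem_roots hz
    obtain ⟨σ, rfl⟩ := minpoly.exists_algEquiv_of_root' (Algebra.IsAlgebraic.isAlgebraic _) hz'
    exact hb σ
  have hcoeff : ∀ i < n, v.1 (q.coeff i : K.1) ≤ ε * 2 ^ d := by
    intro i hi
    rw [h]
    have h1 : P.1 ((q.map (algebraMap ℚ Qbar)).coeff i) ≤ ε ^ (n - i) * n.choose i := by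
      let := P.1.toNormedField
      exact Polynomial.coeff_le_of_roots_le i (minpoly.monic hint)
        (IsAlgClosed.splits _) hroots
    rw [Polynomial.coeff_map, eq_ratCast] at h1
    refine h1.trans (mul_le_mul ?_ ?_ (by positivity) hε0)
    · exact pow_le_of_le_one hε0 hε (by omega)
    · calc (n.choose i : ℝ) ≤ 2 ^ n := by exact_mod_cast Nat.choose_le_two_pow n i
        _ ≤ 2 ^ d := pow_le_pow_right₀ one_le_two hnd
  have heq : b ^ n = -∑ i ∈ Finset.range n, (q.coeff i : K.1) * b ^ i := by
    have := minpoly.aeval ℚ b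
    rw [Polynomial.aeval_eq_sum_range, Finset.sum_range_succ,
      (minpoly.monic hint).coeff_natDegree, one_smul] at this
    rw [eq_neg_iff_add_eq_zero, add_comm, ← this]
    simp only [Algebra.smul_def, eq_ratCast]
    rfl
  have hle : v.1 b ^ n ≤ n * (ε * 2 ^ d * v.1 b ^ (n - 1)) := by
    rw [← map_pow, heq, v.1.map_neg]
    refine (v.1.sum_le _ _).trans ?_
    refine (Finset.sum_le_card_nsmul _ _ (ε * 2 ^ d * v.1 b ^ (n - 1)) ?_).trans
      (by rw [Finset.card_range, nsmul_eq_mul])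
    intro i hi
    rw [Finset.mem_range] at hi
    rw [map_mul, map_pow]
    exact mul_le_mul (hcoeff i hi) (pow_le_pow_right₀ hv.le (by omega))
      (by positivity) (by positivity)
  have hpow : v.1 b ^ n = v.1 b ^ (n - 1) * v.1 b := by
    rw [← pow_succ, Nat.sub_add_cancel hn0]
  have hp : 0 < v.1 b ^ (n - 1) := by positivity
  have h5 : v.1 b ≤ n * (ε * 2 ^ d) := by
    rw [hpow] at hle
    refine le_of_mul_le_mul_left (hle.trans_eq ?_) hp
    ring
  have h6 : (n : ℝ) * (ε * 2 ^ d) ≤ ε * 2 ^ d * d := by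
    rw [mul_comm]
    gcongr
  linarith

/-- The Galois group acts transitively on the places over a place of `ℚ`, archimedean or not.
Otherwise weak approximation yields an element that is large at `v` and small at all conjugates
of `P`, which its minimal polynomial forbids. -/
theorem exists_galois_apply_eq (K : NumField) (v : Place K.1) (P : Place Qbar)
    (h : ∀ q : ℚ, v.1 (q : K.1) = P.1 (q : Qbar)) :
    ∃ σ : GalQ, ∀ x : K.1, P.1 (σ x) = v.1 x := by
  have := K.2
  by_contra! hno
  -- The finitely many absolute values on `K` to separate: `v` and the conjugates of `P`.
  let g : (K.1 →ₐ[ℚ] Qbar) → AbsoluteValue K.1 ℝ :=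
    fun φ => P.1.comp (f := φ.toRingHom) φ.injective
  let res : GalQ → (K.1 →ₐ[ℚ] Qbar) := fun σ => σ.toAlgHom.comp K.1.val
  let s : Set (AbsoluteValue K.1 ℝ) := insert v.1 (Set.range g)
  have hs : s.Finite := (Set.finite_range g).insert _
  have : Finite s := hs
  have hrat : ∀ u ∈ s, ∀ q : ℚ, u (q : K.1) = v.1 (q : K.1) := by
    rintro u (rfl | ⟨φ, rfl⟩) q
    · rfl
    · rw [h]
      exact congrArg P.1 (map_ratCast φ q)
  obtain ⟨q, hq0, hq1⟩ := v.exists_ratCast_apply_ne_one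
  have hqK : (q : K.1) ≠ 0 := by exact_mod_cast hq0
  obtain ⟨a, ha, hlt⟩ := AbsoluteValue.exists_one_lt_lt_one_pi_of_not_isEquiv
    (v := fun u : s => u.1) (fun u => ⟨q, hqK, by rw [hrat _ u.2]; exact hq1⟩)
    (fun u u' hne he => hne (Subtype.ext (eq_of_isEquiv_of_apply_eq he hqK
      (by rw [hrat _ u.2]; exact hq1) (by rw [hrat _ u.2, hrat _ u'.2]))))
    ⟨v.1, Set.mem_insert _ _⟩
  have hσ : ∀ σ : GalQ, P.1 (σ a) < 1 := by
    intro σ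
    refine hlt ⟨g (res σ), Set.mem_insert_of_mem _ ⟨_, rfl⟩⟩ fun he => ?_
    obtain ⟨x, hx⟩ := hno σ
    exact hx (DFunLike.congr_fun (congrArg Subtype.val he) x)
  set d := Module.finrank ℚ K.1
  obtain ⟨ε, hε0, hε1, hεd⟩ : ∃ ε : ℝ, 0 < ε ∧ ε ≤ 1 ∧ ε * 2 ^ d * d < 1 := by
    refine ⟨(2 ^ d * (d + 1) : ℝ)⁻¹, by positivity, inv_le_one_of_one_le₀ ?_, ?_⟩
    · exact one_le_mul_of_one_le_of_one_le (one_le_pow₀ one_le_two) (by simp)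
    · rw [mul_assoc, inv_mul_lt_one₀ (by positivity)]
      gcongr
      simp
  -- A power of `a` has all its conjugates below `ε` at `P`, while it stays large at `v`.
  have hev : ∀ᶠ m : ℕ in Filter.atTop, ∀ u ∈ Set.range (g ∘ res), u a ^ m < ε := by
    refine (Filter.eventually_all_finite
      ((Set.finite_range g).subset (Set.range_comp_subset_range _ _))).2 ?_
    rintro _ ⟨σ, rfl⟩
    exact (tendsto_pow_atTop_nhds_zero_of_lt_one (apply_nonneg _ _)
      (hσ σ)).eventually_lt_const hε0
  obtain ⟨m, hm, hm1⟩ := (hev.and (Filter.eventually_ge_atTop 1)).exists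
  have := apply_le_one_of_conjugates_small K v P h (a ^ m) ε hε1 hεd hε0.le fun σ => by
    have := (hm _ ⟨σ, rfl⟩).le
    rw [← map_pow] at this
    exact this
  rw [map_pow] at this
  exact absurd this (not_le.2 (one_lt_pow₀ ha (by omega)))

/-! ### The functions `f_α` -/

lemma Y.abs_coe (y : Y) (K : NumField) (x : K.1) : y.abs (x : Qbar) = (y.1 K).1 x := by
  have hle : (adjoinField (x : Qbar)).1 ≤ K.1 := by
    change IntermediateField.adjoin ℚ {(x : Qbar)} ≤ K.1
    rw [IntermediateField.adjoin_simple_le_iff]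
    exact x.2
  unfold Y.abs
  rw [← y.2 _ K hle]
  rfl

lemma Y.abs_eq (y : Y) (K : NumField) {α : Qbar} (h : α ∈ K.1) : y.abs α = (y.1 K).1 ⟨α, h⟩ :=
  y.abs_coe K ⟨α, h⟩

lemma Y.abs_galOrbit (P : Place Qbar) (σ : GalQ) (α : Qbar) :
    (galOrbit P σ).abs α = P.1 (σ⁻¹ α) := rfl

/-- The absolute value on `ℚ̄` given by a point of `Y`. -/
def Y.absHom (y : Y) : Qbar →* ℝ where
  toFun := y.abs
  map_one' := by
    rw [y.abs_eq ratField (one_mem _)]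
    exact map_one _
  map_mul' α β := by
    let L : NumField := ⟨(adjoinField α).1 ⊔ (adjoinField β).1, by
      have := (adjoinField α).2
      have := (adjoinField β).2
      exact IntermediateField.finiteDimensional_sup _ _⟩
    have hα : α ∈ L.1 := (le_sup_left : (adjoinField α).1 ≤ L.1)
      (IntermediateField.mem_adjoin_simple_self ℚ α)
    have hβ : β ∈ L.1 := (le_sup_right : (adjoinField β).1 ≤ L.1)
      (IntermediateField.mem_adjoin_simple_self ℚ β)
    rw [y.abs_eq L hα, y.abs_eq L hβ, y.abs_eq L (mul_mem hα hβ), ← map_mul]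
    rfl

lemma Y.abs_pos (y : Y) {α : Qbar} (h : α ≠ 0) : 0 < y.abs α := by
  refine (y.1 (adjoinField α)).1.pos fun h0 => h ?_
  have := congrArg (Subtype.val) h0
  simpa using this

lemma logAbs_one : logAbs 1 = 0 := by
  funext y
  change Real.log (y.absHom 1) = 0
  rw [map_one, Real.log_one]

lemma logAbs_mul {α β : Qbar} (hα : α ≠ 0) (hβ : β ≠ 0) :
    logAbs (α * β) = logAbs α + logAbs β := by
  funext y
  change Real.log (y.absHom (α * β)) = _
  rw [map_mul]
  exact Real.log_mul (y.abs_pos hα).ne' (y.abs_pos hβ).ne'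

lemma logAbs_pow (α : Qbar) (n : ℕ) : logAbs (α ^ n) = n • logAbs α := by
  funext y
  change Real.log (y.absHom (α ^ n)) = _
  rw [map_pow, Real.log_pow, Pi.smul_apply, nsmul_eq_mul]
  rfl

lemma logAbs_inv {α : Qbar} (hα : α ≠ 0) : logAbs α⁻¹ = -logAbs α := by
  rw [eq_neg_iff_add_eq_zero, ← logAbs_mul (inv_ne_zero hα) hα, inv_mul_cancel₀ hα, logAbs_one]

lemma logAbs_prod {O : Finset Qbar} (hO : ∀ β ∈ O, β ≠ 0) (y : Y) :
    logAbs (∏ β ∈ O, β) y = ∑ β ∈ O, logAbs β y := by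
  change Real.log (y.absHom (∏ β ∈ O, β)) = _
  rw [map_prod]
  exact Real.log_prod fun β hβ => (y.abs_pos (hO β hβ)).ne'

lemma logAbs_neg_one : logAbs (-1) = 0 := by
  have h := logAbs_pow (-1) 2
  rw [neg_one_sq, logAbs_one] at h
  funext y
  have := congrFun h y
  simpa using this.symm

lemma continuous_eval (K : NumField) : Continuous fun y : Y => y.1 K :=
  (continuous_apply K).comp continuous_subtype_val

lemma continuous_logAbs (α : Qbar) : Continuous (logAbs α) :=
  (continuous_of_discreteTopology (f := fun v : Place (adjoinField α).1 =>
    Real.log (v.1 (IntermediateField.AdjoinSimple.gen ℚ α)))).comp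
    (continuous_eval (adjoinField α))

/-! ### Norms of numbers with all conjugates on the unit circle -/

/-- The archimedean place of `ℚ̄` given by a complex embedding. -/
def placeOfEmbedding (ι : Qbar →+* ℂ) : Place Qbar :=
  ⟨(NormedField.toAbsoluteValue ℂ).comp (f := ι) ι.injective, Or.inl fun q => by
    change ‖ι (q : Qbar)‖ = _
    rw [map_ratCast, ← Complex.ofReal_ratCast, Complex.norm_real, Real.norm_eq_abs]⟩

lemma norm_embedding_eq_one {S : Set Y} (hS : S ∩ Y.archimedean = ∅) {α : Qbar} (hα : α ≠ 0)
    (hsupp : tsupport (logAbs α) ⊆ S) (ι : Qbar →+* ℂ) : ‖ι α‖ = 1 := by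
  let y := Y.ofPlace (placeOfEmbedding ι)
  have hy : y ∈ Y.archimedean := fun q => by
    change ‖ι ((q : ratField.1) : Qbar)‖ = _
    have : ((q : ratField.1) : Qbar) = q := map_ratCast (algebraMap ratField.1 Qbar) q
    rw [this, map_ratCast, ← Complex.ofReal_ratCast, Complex.norm_real, Real.norm_eq_abs]
  have h0 : logAbs α y = 0 := by
    by_contra hne
    have : y ∈ S ∩ Y.archimedean := ⟨hsupp (subset_tsupport _ hne), hy⟩
    rw [hS] at this
    exact this
  have hpos : 0 < y.abs α := y.abs_pos hα
  exact Real.eq_one_of_pos_of_log_eq_zero hpos h0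

/-- The conjugates over `K` of an algebraic number. -/
def conjugates (K : NumField) (α : Qbar) : Set Qbar := MulAction.orbit K.1.fixingSubgroup α

lemma finite_conjugates (K : NumField) (α : Qbar) : (conjugates K α).Finite := by
  refine ((minpoly ℚ α).rootSet_finite Qbar).subset ?_
  rintro _ ⟨τ, rfl⟩
  rw [Polynomial.mem_rootSet]
  refine ⟨minpoly.ne_zero (Algebra.IsIntegral.isIntegral α), ?_⟩
  change Polynomial.aeval ((τ : GalQ).toAlgHom α) _ = 0
  rw [Polynomial.aeval_algHom_apply, minpoly.aeval, map_zero]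

/-- The product of the conjugates lies in `K` and has all conjugates on the unit circle; at the
real place of `K` the only such numbers are `1` and `-1`. -/
lemma prod_conjugates_eq (K : NumField) (hK : ∃ w : NumberField.InfinitePlace K.1, w.IsReal)
    {α : Qbar} (hα : ∀ ι : Qbar →+* ℂ, ‖ι α‖ = 1) :
    (∏ β ∈ (finite_conjugates K α).toFinset, β) = 1 ∨
      (∏ β ∈ (finite_conjugates K α).toFinset, β) = -1 := by
  set N := ∏ β ∈ (finite_conjugates K α).toFinset, β with hN
  have hmem : N ∈ K.1 := by
    rw [← InfiniteGalois.fixedField_fixingSubgroup K.1, IntermediateField.mem_fixedField_iff]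
    intro τ hτ
    rw [hN, map_prod]
    refine Finset.prod_bijective τ τ.bijective (fun β => ?_) (fun _ _ => rfl)
    simp only [Set.Finite.mem_toFinset]
    change _ ↔ (⟨τ, hτ⟩ : K.1.fixingSubgroup) • β ∈ MulAction.orbit K.1.fixingSubgroup α
    rw [← MulAction.orbit_eq_iff, MulAction.orbit_smul, MulAction.orbit_eq_iff]
    rfl
  obtain ⟨w, hw⟩ := hK
  let e : K.1 →+* ℝ := NumberField.InfinitePlace.embedding_of_isReal hw
  let : Algebra K.1 ℂ := (Complex.ofRealHom.comp e).toAlgebra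
  let ι : Qbar →ₐ[K.1] ℂ := IsAlgClosed.lift
  have hι : ι N = (e ⟨N, hmem⟩ : ℂ) := ι.commutes ⟨N, hmem⟩
  have hnorm : ‖ι N‖ = 1 := by
    rw [hN, map_prod, norm_prod]
    refine Finset.prod_eq_one fun β hβ => ?_
    rw [Set.Finite.mem_toFinset] at hβ
    obtain ⟨τ, rfl⟩ := hβ
    exact hα (ι.toRingHom.comp (τ : GalQ).toRingEquiv.toRingHom)
  rw [hι, Complex.norm_real, Real.norm_eq_abs] at hnorm
  rcases eq_or_eq_neg_of_abs_eq hnorm with h | h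
  · left
    have := e.injective (h.trans (map_one e).symm)
    exact congrArg Subtype.val this
  · right
    have := e.injective (h.trans (by rw [map_neg, map_one] : e (-1) = -1).symm)
    exact congrArg Subtype.val this

open MeasureTheory

/-! ### The topology of `Y` and the orbit maps -/

instance : T2Space Y := inferInstanceAs (T2Space (Subtype _))

lemma isDefinedOver_over (K : NumField) (v : Place K.1) : IsDefinedOver (Y.over K v) K :=
  ⟨{v}, by simp⟩

lemma IsDefinedOver.exists_preimage {B : Set Y} {K : NumField} (hB : IsDefinedOver B K) :
    ∃ T : Set (Place K.1), B = (fun y : Y => y.1 K) ⁻¹' T := by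
  obtain ⟨T, rfl⟩ := hB
  exact ⟨T, by ext y; simp [Y.over]⟩

lemma IsDefinedOver.mem_iff {B : Set Y} {K : NumField} (hB : IsDefinedOver B K) {y z : Y}
    (h : y.1 K = z.1 K) : y ∈ B ↔ z ∈ B := by
  obtain ⟨T, rfl⟩ := hB.exists_preimage
  simp only [Set.mem_preimage, h]

lemma IsDefinedOver.isClopen {B : Set Y} {K : NumField} (hB : IsDefinedOver B K) :
    IsClopen B := by
  obtain ⟨T, rfl⟩ := hB.exists_preimage
  exact (isClopen_discrete T).preimage (continuous_eval K)

lemma IsDefinedOver.measurableSet {B : Set Y} {K : NumField} (hB : IsDefinedOver B K) :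
    MeasurableSet B :=
  hB.isClopen.isOpen.measurableSet

lemma galOrbit_mul_eval (P : Place Qbar) (K : NumField) {τ : GalQ}
    (hτ : τ ∈ K.1.fixingSubgroup) (σ : GalQ) :
    (galOrbit P (τ * σ)).1 K = (galOrbit P σ).1 K := by
  apply Subtype.ext
  ext x
  change P.1 ((τ * σ)⁻¹ (x : Qbar)) = P.1 (σ⁻¹ (x : Qbar))
  rw [mul_inv_rev, AlgEquiv.mul_apply,
    (IntermediateField.mem_fixingSubgroup_iff _ _).1 (inv_mem hτ) _ x.2]

lemma continuous_galOrbit (P : Place Qbar) : Continuous (galOrbit P) := by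
  refine Continuous.subtype_mk (continuous_pi fun K => ?_) _
  have := K.2
  refine ((IsLocallyConstant.iff_exists_open _).2 fun σ => ?_).continuous
  refine ⟨{ρ | ρ * σ⁻¹ ∈ K.1.fixingSubgroup}, ?_, ?_, fun ρ hρ => ?_⟩
  · exact (IntermediateField.fixingSubgroup_isOpen K.1).preimage (continuous_mul_const σ⁻¹)
  · simp
  · have := galOrbit_mul_eval P K hρ σ
    rwa [inv_mul_cancel_right] at this

/-! ### The measure `λ` -/

instance : galHaar.IsHaarMeasure := Measure.isHaarMeasure_haarMeasure _

instance : IsProbabilityMeasure galHaar := ⟨Measure.haarMeasure_self⟩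

instance (P : Place Qbar) : IsProbabilityMeasure (galHaar.map (galOrbit P)) :=
  Measure.isProbabilityMeasure_map (continuous_galOrbit P).aemeasurable

/-- The `p`-adic place that `placeMeasure` is built from. -/
def primePlace (p : Nat.Primes) : Place Qbar :=
  have : Fact (p : ℕ).Prime := ⟨p.2⟩
  placePadic p

lemma placeMeasure_eq : placeMeasure = galHaar.map (galOrbit placeInfty) +
    Measure.sum fun p => galHaar.map (galOrbit (primePlace p)) := rfl

lemma placeInfty_ratCast (q : ℚ) : placeInfty.1 (q : Qbar) = |(q : ℝ)| := by
  change ‖(IsAlgClosed.lift : Qbar →ₐ[ℚ] ℂ) (q : Qbar)‖ = _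
  rw [map_ratCast, ← Complex.ofReal_ratCast, Complex.norm_real, Real.norm_eq_abs]

lemma primePlace_ratCast (p : Nat.Primes) (q : ℚ) :
    (primePlace p).1 (q : Qbar) = padicNorm p q := by
  have : Fact (p : ℕ).Prime := ⟨p.2⟩
  change ‖(IsAlgClosed.lift : Qbar →ₐ[ℚ] PadicAlgCl p) (q : Qbar)‖ = _
  rw [map_ratCast, ← map_ratCast (algebraMap ℚ_[p] (PadicAlgCl p)), PadicAlgCl.norm_extends,
    Padic.eq_padicNorm]

lemma galOrbit_eval_ratCast (P : Place Qbar) (σ : GalQ) (K : NumField) (q : ℚ) :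
    ((galOrbit P σ).1 K).1 (q : K.1) = P.1 (q : Qbar) := by
  change P.1 (σ⁻¹ (algebraMap K.1 Qbar (q : K.1))) = _
  rw [map_ratCast, map_ratCast]

lemma galHaar_map_over_pos (K : NumField) (v : Place K.1) (P : Place Qbar)
    (h : ∀ q : ℚ, v.1 (q : K.1) = P.1 (q : Qbar)) :
    0 < galHaar.map (galOrbit P) (Y.over K v) := by
  have ho := (isDefinedOver_over K v).isClopen.isOpen
  rw [Measure.map_apply (continuous_galOrbit P).measurable ho.measurableSet]
  refine (ho.preimage (continuous_galOrbit P)).measure_pos galHaar ?_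
  obtain ⟨σ, hσ⟩ := exists_galois_apply_eq K v P h
  refine ⟨σ⁻¹, Subtype.ext (AbsoluteValue.ext fun x => ?_)⟩
  rw [← hσ]
  change P.1 (σ⁻¹⁻¹ (x : Qbar)) = _
  rw [inv_inv]

lemma placeMeasure_over_pos (K : NumField) (v : Place K.1) :
    0 < placeMeasure (Y.over K v) := by
  rw [placeMeasure_eq]
  rcases v.2 with h | ⟨p, hp, h⟩
  · exact (galHaar_map_over_pos K v placeInfty fun q => by
      rw [h, placeInfty_ratCast]).trans_le (Measure.le_add_right le_rfl _)
  · let r : Nat.Primes := ⟨p, hp⟩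
    exact (galHaar_map_over_pos K v (primePlace r) fun q =>
      (h q).trans (primePlace_ratCast r q).symm).trans_le
      ((Measure.le_sum (fun p => galHaar.map (galOrbit (primePlace p))) r _).trans
        (Measure.le_add_left le_rfl _))

lemma ratCast_eq_of_map_ne_zero {u : Place ratField.1} {P : Place Qbar}
    (h : galHaar.map (galOrbit P) (Y.over ratField u) ≠ 0) (q : ℚ) :
    P.1 (q : Qbar) = u.1 (q : ratField.1) := by
  rw [Measure.map_apply (continuous_galOrbit P).measurable
    (isDefinedOver_over _ _).measurableSet] at h
  obtain ⟨σ, hσ⟩ := nonempty_of_measure_ne_zero h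
  rw [← galOrbit_eval_ratCast P σ ratField]
  exact congrArg (fun w : Place ratField.1 => w.1 (q : ratField.1)) hσ

lemma padicNorm_injective {p p' : Nat.Primes} (h : ∀ q : ℚ, padicNorm p q = padicNorm p' q) :
    p = p' := by
  by_contra hne
  have : Fact (p : ℕ).Prime := ⟨p.2⟩
  have : Fact (p' : ℕ).Prime := ⟨p'.2⟩
  have h1 := h p
  rw [padicNorm.padicNorm_p p.2.one_lt,
    padicNorm.padicNorm_of_prime_of_ne fun he => hne (Subtype.ext he.symm)] at h1
  have : (1 : ℚ) < p := by exact_mod_cast p.2.one_lt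
  exact (inv_lt_one_of_one_lt₀ this).ne h1

/-- At most one of the `p`-adic orbit measures charges `Y(ℚ,u)`. -/
lemma placeMeasure_over_ratField_lt_top (u : Place ratField.1) :
    placeMeasure (Y.over ratField u) < ∞ := by
  rw [placeMeasure_eq, Measure.add_apply,
    Measure.sum_apply _ (isDefinedOver_over _ _).measurableSet]
  refine ENNReal.add_lt_top.2 ⟨measure_lt_top _ _, ?_⟩
  by_cases hex : ∃ p, galHaar.map (galOrbit (primePlace p)) (Y.over ratField u) ≠ 0
  · obtain ⟨p, hp⟩ := hex
    rw [tsum_eq_single p]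
    · exact measure_lt_top _ _
    · intro p' hne
      by_contra hp'
      refine hne (padicNorm_injective fun q => ?_)
      have := (ratCast_eq_of_map_ne_zero hp' q).trans (ratCast_eq_of_map_ne_zero hp q).symm
      rw [primePlace_ratCast, primePlace_ratCast] at this
      exact_mod_cast this
  · push Not at hex
    simp [hex]

instance : IsLocallyFiniteMeasure placeMeasure := ⟨fun y =>
  ⟨Y.over ratField (y.1 ratField),
    (isDefinedOver_over _ _).isClopen.isOpen.mem_nhds rfl,
    placeMeasure_over_ratField_lt_top _⟩⟩

/-! ### Vanishing of the local integrals -/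

lemma logAbs_apply_galOrbit (P : Place Qbar) (τ σ : GalQ) (α : Qbar) :
    logAbs (τ α) (galOrbit P σ) = logAbs α (galOrbit P (τ⁻¹ * σ)) := by
  unfold logAbs
  rw [Y.abs_galOrbit, Y.abs_galOrbit, mul_inv_rev, inv_inv, AlgEquiv.mul_apply]

/-- The integrals over `B` of `f_β`, for the conjugates `β` of `α` over `K`, coincide because the
Haar measure is invariant, and they add up to the integral of `f_N` for `N = ± 1`. -/
lemma setIntegral_map_logAbs_eq_zero (P : Place Qbar) {K : NumField}
    (hK : ∃ w : NumberField.InfinitePlace K.1, w.IsReal) {B : Set Y} (hB : IsDefinedOver B K)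
    {α : Qbar} (h0 : α ≠ 0) (hα : ∀ ι : Qbar →+* ℂ, ‖ι α‖ = 1) :
    ∫ y in B, logAbs α y ∂(galHaar.map (galOrbit P)) = 0 := by
  have hc := continuous_galOrbit P
  rw [setIntegral_map hB.measurableSet (continuous_logAbs α).aestronglyMeasurable
    hc.aemeasurable]
  set A := galOrbit P ⁻¹' B
  have hA : IsClopen A := hB.isClopen.preimage hc
  set O := (finite_conjugates K α).toFinset with hO
  have hmem : ∀ β ∈ O, ∃ τ : K.1.fixingSubgroup, (τ : GalQ) α = β := by
    intro β hβ
    rw [hO, Set.Finite.mem_toFinset] at hβ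
    exact hβ
  have hsum : ∑ β ∈ O, ∫ σ in A, logAbs β (galOrbit P σ) ∂galHaar = 0 := by
    rw [← integral_finsetSum]
    · have hN : logAbs (∏ β ∈ O, β) = 0 := by
        rcases prod_conjugates_eq K hK hα with h | h
        · rw [h, logAbs_one]
        · rw [h, logAbs_neg_one]
      have : ∀ σ, ∑ β ∈ O, logAbs β (galOrbit P σ) = 0 := by
        intro σ
        rw [← logAbs_prod, hN, Pi.zero_apply]
        intro β hβ
        obtain ⟨τ, rfl⟩ := hmem β hβ
        exact (map_ne_zero (τ : GalQ)).2 h0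
      simp [this]
    · intro β _
      exact (((continuous_logAbs β).comp hc).integrable_of_hasCompactSupport
        (HasCompactSupport.of_compactSpace _)).integrableOn
  have heq : ∀ β ∈ O, ∫ σ in A, logAbs β (galOrbit P σ) ∂galHaar =
      ∫ σ in A, logAbs α (galOrbit P σ) ∂galHaar := by
    intro β hβ
    obtain ⟨τ, rfl⟩ := hmem β hβ
    rw [← integral_indicator hA.isOpen.measurableSet, ← integral_indicator hA.isOpen.measurableSet,
      ← integral_mul_left_eq_self (A.indicator fun σ => logAbs α (galOrbit P σ)) (τ : GalQ)⁻¹]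
    refine integral_congr_ae (Filter.Eventually.of_forall fun σ => ?_)
    have hiff : (τ : GalQ)⁻¹ * σ ∈ A ↔ σ ∈ A :=
      hB.mem_iff (galOrbit_mul_eval P K (inv_mem τ.2) σ)
    by_cases hσ : σ ∈ A
    · simp only [Set.indicator_of_mem hσ, Set.indicator_of_mem (hiff.2 hσ)]
      exact logAbs_apply_galOrbit P τ σ α
    · simp only [Set.indicator_of_notMem hσ, Set.indicator_of_notMem (mt hiff.1 hσ)]
  rw [Finset.sum_congr rfl heq, Finset.sum_const, nsmul_eq_mul, mul_eq_zero] at hsum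
  refine hsum.resolve_left ?_
  have : α ∈ O := by
    rw [hO, Set.Finite.mem_toFinset]
    exact MulAction.mem_orbit_self α
  exact_mod_cast (Finset.card_pos.2 ⟨α, this⟩).ne'

lemma integrable_unitFunction {S : Set Y} (hS : IsCompact S) {f : Y → ℝ}
    (hf : f ∈ unitFunctions S) : Integrable f placeMeasure := by
  obtain ⟨⟨α, -, rfl⟩, hsupp⟩ := hf
  exact (continuous_logAbs α).integrable_of_hasCompactSupport
    (hS.of_isClosed_subset (isClosed_tsupport _) hsupp)

/-- The obstruction: over a field with a real place, every function of `ℱ(S)` has integral zero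
over each set that is defined over that field. -/
theorem setIntegral_unitFunction_eq_zero {S : Set Y} (hS : IsCompact S)
    (hS_arch : S ∩ Y.archimedean = ∅) {K : NumField}
    (hK : ∃ w : NumberField.InfinitePlace K.1, w.IsReal) {B : Set Y} (hB : IsDefinedOver B K)
    {f : Y → ℝ} (hf : f ∈ unitFunctions S) : ∫ y in B, f y ∂placeMeasure = 0 := by
  have hint := (integrable_unitFunction hS hf).restrict (s := B)
  obtain ⟨⟨α, h0, rfl⟩, hsupp⟩ := hf
  have hα := norm_embedding_eq_one hS_arch h0 hsupp
  rw [placeMeasure_eq, Measure.restrict_add,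
    Measure.restrict_sum _ hB.measurableSet] at hint ⊢
  obtain ⟨h1, h2⟩ := integrable_add_measure.1 hint
  rw [integral_add_measure h1 h2, setIntegral_map_logAbs_eq_zero _ hK hB h0 hα, zero_add]
  refine (hasSum_integral_measure h2).unique ?_
  simp_rw [setIntegral_map_logAbs_eq_zero _ hK hB h0 hα]
  exact hasSum_zero

/-! ### Closures of rational subspaces -/

/-- The closure of a `ℚ`-subspace of a real normed space is a real subspace. -/
lemma exists_submodule_eq_closure {E : Type*} [NormedAddCommGroup E] [NormedSpace ℝ E] {G : Set E}
    (hzero : 0 ∈ G) (hadd : ∀ f ∈ G, ∀ g ∈ G, f + g ∈ G)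
    (hsmul : ∀ q : ℚ, ∀ g ∈ G, (q : ℝ) • g ∈ G) :
    ∃ W : Submodule ℝ E, (W : Set E) = closure G := by
  refine ⟨{ carrier := closure G
            zero_mem' := subset_closure hzero
            add_mem' := fun hf hg => map_mem_closure₂ continuous_add hf hg hadd
            smul_mem' := fun c g hg => ?_ }, rfl⟩
  have hclosed : IsClosed {c : ℝ | c • g ∈ closure G} :=
    isClosed_closure.preimage (continuous_id.smul continuous_const)
  refine hclosed.closure_subset_iff.2 ?_ (Rat.denseRange_cast (𝕜 := ℝ) c)
  rintro _ ⟨q, rfl⟩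
  exact map_mem_closure (continuous_const_smul (q : ℝ)) hg (hsmul q)

/-- A continuous functional that vanishes on `G` but not on `H` separates `H` from the
closure of `G`. -/
lemma exists_submodule_eq_closure_ssubset {E : Type*} [NormedAddCommGroup E] [NormedSpace ℝ E]
    {G H : Set E} (hzero : 0 ∈ G) (hadd : ∀ f ∈ G, ∀ g ∈ G, f + g ∈ G)
    (hsmul : ∀ q : ℚ, ∀ g ∈ G, (q : ℝ) • g ∈ G) (hGH : G ⊆ H) (hH : IsClosed H) {ψ : E → ℝ}
    (hψ : Continuous ψ) (hψG : ∀ g ∈ G, ψ g = 0) {h : E} (hh : h ∈ H) (hψh : ψ h ≠ 0) :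
    ∃ W : Submodule ℝ E, (W : Set E) = closure G ∧ (W : Set E) ⊂ H := by
  obtain ⟨W, hW⟩ := exists_submodule_eq_closure hzero hadd hsmul
  refine ⟨W, hW, ?_⟩
  rw [hW]
  refine ⟨closure_minimal hGH hH, fun hsub => hψh ?_⟩
  exact closure_minimal hψG (isClosed_singleton.preimage hψ) (hsub hh)

/-! ### `ℱ(S)` as a rational vector space -/

lemma zero_mem_unitFunctions (S : Set Y) : (0 : Y → ℝ) ∈ unitFunctions S :=
  ⟨⟨1, one_ne_zero, logAbs_one.symm⟩, by simp [tsupport]⟩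

lemma add_mem_unitFunctions {S : Set Y} {f g : Y → ℝ} (hf : f ∈ unitFunctions S)
    (hg : g ∈ unitFunctions S) : f + g ∈ unitFunctions S := by
  obtain ⟨⟨α, hα, rfl⟩, hf⟩ := hf
  obtain ⟨⟨β, hβ, rfl⟩, hg⟩ := hg
  exact ⟨⟨α * β, mul_ne_zero hα hβ, (logAbs_mul hα hβ).symm⟩,
    (tsupport_add _ _).trans (Set.union_subset hf hg)⟩

/-- Multiplication by `1 / n` is realised by an `n`-th root. -/
lemma smul_mem_unitFunctions {S : Set Y} (q : ℚ) {f : Y → ℝ} (hf : f ∈ unitFunctions S) :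
    (q : ℝ) • f ∈ unitFunctions S := by
  obtain ⟨⟨α, hα, rfl⟩, hf⟩ := hf
  refine ⟨?_, (closure_mono (Function.support_const_smul_subset _ _)).trans hf⟩
  obtain ⟨γ, hγ⟩ := IsAlgClosed.exists_pow_nat_eq α q.den_pos
  have hγ0 : γ ≠ 0 := by
    rintro rfl
    rw [zero_pow q.den_nz] at hγ
    exact hα hγ.symm
  have hden : (q.den : ℝ) ≠ 0 := by exact_mod_cast q.den_nz
  have h1 : (q : ℝ) • logAbs α = (q.num : ℝ) • logAbs γ := by
    rw [← hγ, logAbs_pow, ← Nat.cast_smul_eq_nsmul ℝ, smul_smul]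
    congr 1
    exact_mod_cast Rat.mul_den_eq_num q
  obtain ⟨n, hn | hn⟩ := q.num.eq_nat_or_neg
  · refine ⟨γ ^ n, pow_ne_zero _ hγ0, ?_⟩
    rw [h1, hn, logAbs_pow, ← Nat.cast_smul_eq_nsmul ℝ, Int.cast_natCast]
  · refine ⟨(γ ^ n)⁻¹, inv_ne_zero (pow_ne_zero _ hγ0), ?_⟩
    rw [h1, hn, logAbs_inv (pow_ne_zero _ hγ0), logAbs_pow, ← Nat.cast_smul_eq_nsmul ℝ,
      Int.cast_neg, Int.cast_natCast, neg_smul]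

/-! ### Continuity of the integral over a set of finite measure -/

lemma continuous_setIntegral_Lp {X : Type*} [MeasurableSpace X] {μ : Measure X} {p : ℝ≥0∞}
    [hp : Fact (1 ≤ p)] {B : Set X} (hB : μ B ≠ ∞) :
    Continuous fun g : Lp ℝ p μ => ∫ y in B, g y ∂μ := by
  have : IsFiniteMeasure (μ.restrict B) := ⟨by simpa using hB.lt_top⟩
  have hint : ∀ g : Lp ℝ p μ, Integrable g (μ.restrict B) := fun g =>
    ((Lp.memLp g).restrict B).integrable hp.out
  set C := μ B ^ (1 - 1 / p.toReal)
  have hC : C ≠ ∞ := by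
    refine (ENNReal.rpow_lt_top_of_nonneg ?_ hB).ne
    rcases eq_or_ne p ∞ with rfl | hpt
    · simp
    · rw [sub_nonneg, one_div]
      exact inv_le_one_of_one_le₀ (by simpa using ENNReal.toReal_mono hpt hp.out)
  refine (LipschitzWith.of_dist_le_mul (K := C.toNNReal) fun f g => ?_).continuous
  rw [dist_eq_norm, dist_eq_norm, ← integral_sub (hint f) (hint g)]
  have hcongr : ∫ y in B, (f y - g y) ∂μ = ∫ y in B, (f - g : Lp ℝ p μ) y ∂μ :=
    integral_congr_ae (ae_restrict_of_ae ((Lp.coeFn_sub f g).mono fun y hy => hy.symm))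
  rw [hcongr]
  refine (norm_integral_le_integral_norm _).trans ?_
  rw [integral_norm_eq_lintegral_enorm (hint _).aestronglyMeasurable,
    ← eLpNorm_one_eq_lintegral_enorm, Lp.norm_def, ENNReal.coe_toNNReal_eq_toReal,
    ← ENNReal.toReal_mul, mul_comm]
  refine ENNReal.toReal_mono (ENNReal.mul_ne_top (Lp.eLpNorm_ne_top _) hC) ?_
  refine (eLpNorm_le_eLpNorm_mul_rpow_measure_univ hp.out
    (hint _).aestronglyMeasurable).trans ?_
  rw [Measure.restrict_apply_univ, ENNReal.toReal_one, div_one]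
  gcongr
  exact Measure.restrict_le_self

lemma isClosed_setOf_ae_eq_zero_off {X : Type*} [MeasurableSpace X] {μ : Measure X} {p : ℝ≥0∞}
    [Fact (1 ≤ p)] {S : Set X} (hS : MeasurableSet S) :
    IsClosed {g : Lp ℝ p μ | ∀ᵐ y ∂μ, y ∉ S → g y = 0} := by
  convert isClosed_singleton.preimage (LpToLpRestrictCLM X ℝ ℝ μ p Sᶜ).continuous
    (t := {0}) using 1
  ext g
  rw [Set.mem_preimage, Set.mem_singleton_iff, Lp.eq_zero_iff_ae_eq_zero]
  refine (ae_restrict_iff' hS.compl).symm.trans ?_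
  have h := LpToLpRestrictCLM_coeFn ℝ Sᶜ g
  exact ⟨fun h0 => h.trans h0, fun h0 => h.symm.trans h0⟩

lemma norm_apply_le_norm {X : Type*} [TopologicalSpace X] (g : C₀(X, ℝ)) (x : X) :
    ‖g x‖ ≤ ‖g‖ :=
  g.toBCF.norm_coe_le_norm x

lemma continuous_setIntegral_C₀ {X : Type*} [TopologicalSpace X] [MeasurableSpace X]
    [BorelSpace X] [T2Space X] {μ : Measure X} [IsFiniteMeasureOnCompacts μ] {B : Set X}
    (hB : IsCompact B) : Continuous fun g : C₀(X, ℝ) => ∫ y in B, g y ∂μ := by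
  have hint : ∀ g : C₀(X, ℝ), IntegrableOn g B μ := fun g =>
    (map_continuous g).continuousOn.integrableOn_compact hB
  refine (LipschitzWith.of_dist_le_mul (K := (μ B).toNNReal) fun f g => ?_).continuous
  rw [dist_eq_norm, dist_eq_norm, ← integral_sub (hint f) (hint g), mul_comm]
  exact norm_setIntegral_le_of_norm_le_const hB.measure_lt_top
    fun y _ => norm_apply_le_norm (f - g) y

lemma isClosed_setOf_tsupport_subset {X : Type*} [TopologicalSpace X] {S : Set X}
    (hS : IsClosed S) : IsClosed {g : C₀(X, ℝ) | tsupport g ⊆ S} := by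
  have : {g : C₀(X, ℝ) | tsupport g ⊆ S} = ⋂ y ∈ Sᶜ, {g | g y = 0} := by
    ext g
    simp only [Set.mem_ofPred_eq, Set.mem_iInter, tsupport, hS.closure_subset_iff]
    exact ⟨fun h y hy => by_contra fun h0 => hy (h h0),
      fun h y hy => by_contra fun h0 => hy (h y h0)⟩
  rw [this]
  refine isClosed_biInter fun y _ => isClosed_eq ?_ continuous_const
  refine (LipschitzWith.of_dist_le_mul (K := 1) fun f g => ?_).continuous
  rw [dist_eq_norm, dist_eq_norm, NNReal.coe_one, one_mul]
  exact norm_apply_le_norm (f - g) y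

/-! ### A function outside the closure -/

/-- The function takes opposite masses on `Y(K,v)` and `Y(K,w)`. -/
lemma exists_continuous_setIntegral_ne_zero {S : Set Y} (hS : IsCompact S) {K : NumField}
    {v w : Place K.1} (hvw : v ≠ w) (hvwS : Y.over K v ∪ Y.over K w ⊆ S) :
    ∃ φ : Y → ℝ, Continuous φ ∧ tsupport φ ⊆ S ∧ ∫ y in S, φ y ∂placeMeasure = 0 ∧
      ∫ y in Y.over K v, φ y ∂placeMeasure ≠ 0 := by
  set V := Y.over K v
  set U := Y.over K w
  have hVS : V ⊆ S := Set.subset_union_left.trans hvwS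
  have hUS : U ⊆ S := Set.subset_union_right.trans hvwS
  have hV : IsClopen V := (isDefinedOver_over K v).isClopen
  have hU : IsClopen U := (isDefinedOver_over K w).isClopen
  have hVm : MeasurableSet V := hV.isOpen.measurableSet
  have hUm : MeasurableSet U := hU.isOpen.measurableSet
  have hVc : IsCompact V := hS.of_isClosed_subset hV.isClosed hVS
  have hUc : IsCompact U := hS.of_isClosed_subset hU.isClosed hUS
  have hdisj : V ∩ U = ∅ := by
    ext y
    simp only [Set.mem_inter_iff, Set.mem_empty_iff_false, iff_false, not_and]
    exact fun h1 h2 => hvw (h1.symm.trans h2)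
  set a := placeMeasure.real V
  set b := placeMeasure.real U
  have ha : 0 < a := ENNReal.toReal_pos (placeMeasure_over_pos K v).ne' hVc.measure_lt_top.ne
  have hb : 0 < b := ENNReal.toReal_pos (placeMeasure_over_pos K w).ne' hUc.measure_lt_top.ne
  have hi (c : ℝ) {A : Set Y} (hA : IsCompact A) (hAm : MeasurableSet A) (T : Set Y) :
      IntegrableOn (A.indicator fun _ => c) T placeMeasure :=
    ((integrable_indicator_iff hAm).2 (integrableOn_const hA.measure_lt_top.ne)).integrableOn
  refine ⟨V.indicator (fun _ => b) - U.indicator (fun _ => a),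
    (continuous_const.indicator fun x hx => ?_).sub
      (continuous_const.indicator fun x hx => ?_), ?_, ?_, ?_⟩
  · rw [hV.frontier_eq] at hx
    exact hx.elim
  · rw [hU.frontier_eq] at hx
    exact hx.elim
  · refine closure_minimal (fun y hy => ?_) hS.isClosed
    by_contra hyS
    refine hy ?_
    rw [Pi.sub_apply, Set.indicator_of_notMem fun h => hyS (hVS h),
      Set.indicator_of_notMem fun h => hyS (hUS h), sub_zero]
  · simp only [Pi.sub_apply]
    rw [integral_sub (hi b hVc hVm S) (hi a hUc hUm S), setIntegral_indicator hVm,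
      setIntegral_indicator hUm, Set.inter_eq_self_of_subset_right hVS,
      Set.inter_eq_self_of_subset_right hUS, setIntegral_const, setIntegral_const, smul_eq_mul,
      smul_eq_mul, mul_comm, sub_self]
  · simp only [Pi.sub_apply]
    rw [integral_sub (hi b hVc hVm V) (hi a hUc hUm V), setIntegral_indicator hVm,
      setIntegral_indicator hUm, Set.inter_self, hdisj, setIntegral_const, setIntegral_empty,
      sub_zero, smul_eq_mul]
    exact (mul_pos ha hb).ne'

end WeilHeight

end

open WeilHeight MeasureTheory in
theorem theorem3 (S : Set WeilHeight.Y) (hS_compact : IsCompact S) (hS_open : IsOpen S)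
    (hS_arch : S ∩ WeilHeight.Y.archimedean = ∅)
    (K : WeilHeight.NumField) (hSK : WeilHeight.IsDefinedOver S K)
    (hK_real : ∃ w : NumberField.InfinitePlace K.1, w.IsReal)
    (v w : WeilHeight.Place K.1) (hvw : v ≠ w)
    (hvwS : WeilHeight.Y.over K v ∪ WeilHeight.Y.over K w ⊆ S) :
    (∀ (p : ℝ≥0∞) [Fact (1 ≤ p)], p ≠ ∞ →
      ∃ W : Submodule ℝ (MeasureTheory.Lp ℝ p WeilHeight.placeMeasure),
        (W : Set (MeasureTheory.Lp ℝ p WeilHeight.placeMeasure)) =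
            closure (WeilHeight.unitLp p S) ∧
          (W : Set (MeasureTheory.Lp ℝ p WeilHeight.placeMeasure)) ⊂
            WeilHeight.hyperplaneLp p S) ∧
    ∃ W : Submodule ℝ C₀(WeilHeight.Y, ℝ),
      (W : Set C₀(WeilHeight.Y, ℝ)) = closure (WeilHeight.unitC₀ S) ∧
        (W : Set C₀(WeilHeight.Y, ℝ)) ⊂ WeilHeight.hyperplaneC₀ S := by
  obtain ⟨φ, hφ, hφS, hφ0, hφV⟩ := exists_continuous_setIntegral_ne_zero hS_compact hvw hvwS
  have hφc : HasCompactSupport φ := hS_compact.of_isClosed_subset (isClosed_tsupport _) hφS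
  have hV := isDefinedOver_over K v
  have hVc : IsCompact (Y.over K v) :=
    hS_compact.of_isClosed_subset hV.isClopen.isClosed (Set.subset_union_left.trans hvwS)
  have hzero {B : Set Y} (hB : IsDefinedOver B K) {f : Y → ℝ} (hf : f ∈ unitFunctions S) :
      ∫ y in B, f y ∂placeMeasure = 0 :=
    setIntegral_unitFunction_eq_zero hS_compact hS_arch hK_real hB hf
  constructor
  · intro p hp hpt
    have hmem : MemLp φ p placeMeasure := hφ.memLp_of_hasCompactSupport hφc
    have hφae := hmem.coeFn_toLp
    refine exists_submodule_eq_closure_ssubset ?_ ?_ ?_ ?_ ?_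
      (continuous_setIntegral_Lp (B := Y.over K v) hVc.measure_lt_top.ne) ?_
      (h := hmem.toLp φ) ?_ ?_
    · exact ⟨0, zero_mem_unitFunctions S, Lp.coeFn_zero _ _ _⟩
    · rintro f ⟨f', hf', hf⟩ g ⟨g', hg', hg⟩
      exact ⟨_, add_mem_unitFunctions hf' hg', (Lp.coeFn_add f g).trans (hf.add hg)⟩
    · rintro q f ⟨f', hf', hf⟩
      exact ⟨_, smul_mem_unitFunctions q hf',
        (Lp.coeFn_smul (q : ℝ) f).trans (hf.const_smul (q : ℝ))⟩
    · rintro f ⟨f', hf', hf⟩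
      refine ⟨hf.mono fun y hy hyS => ?_, ?_⟩
      · rw [hy]
        exact image_eq_zero_of_notMem_tsupport fun h => hyS (hf'.2 h)
      · rw [integral_congr_ae (ae_restrict_of_ae hf), hzero hSK hf']
    · exact (isClosed_setOf_ae_eq_zero_off hSK.measurableSet).inter (isClosed_singleton.preimage
        (continuous_setIntegral_Lp (B := S) hS_compact.measure_lt_top.ne))
    · rintro f ⟨f', hf', hf⟩
      rw [integral_congr_ae (ae_restrict_of_ae hf), hzero hV hf']
    · refine ⟨hφae.mono fun y hy hyS => ?_, ?_⟩
      · rw [hy]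
        exact image_eq_zero_of_notMem_tsupport fun h => hyS (hφS h)
      · rw [integral_congr_ae (ae_restrict_of_ae hφae), hφ0]
    · rwa [integral_congr_ae (ae_restrict_of_ae hφae)]
  · let Φ : C₀(Y, ℝ) := ⟨⟨φ, hφ⟩, hφc.is_zero_at_infty⟩
    refine exists_submodule_eq_closure_ssubset ?_ ?_ ?_ ?_ ?_
      (continuous_setIntegral_C₀ (μ := placeMeasure) hVc) ?_ (h := Φ) ⟨hφS, hφ0⟩ hφV
    · exact zero_mem_unitFunctions S
    · exact fun f hf g hg => add_mem_unitFunctions hf hg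
    · exact fun q f hf => smul_mem_unitFunctions q hf
    · exact fun f hf => ⟨hf.2, hzero hSK hf⟩
    · exact (isClosed_setOf_tsupport_subset hS_compact.isClosed).inter (isClosed_singleton.preimage
        (continuous_setIntegral_C₀ (μ := placeMeasure) hS_compact))
    · exact fun f hf => hzero hV hf
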